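/- Let $\mathbb{T}^2=\mathbb{R}^2/\mathbb{Z}^2$, on which the Lie group $\mathbb{R}^2$ acts by translations. Let $\pi:L\to\mathbb{T}^2$ be an $\mathbb{R}^2$-equivariant smooth complex line bundle, i.e. a smooth complex line bundle together with a smooth action of $\mathbb{R}^2$ on the total space $L$ such that $\pi(g\cdot p)=g\cdot\pi(p)$ for all $g\in\mathbb{R}^2$, $p\in L$, and such that each $g$ maps $L_x$ to $L_{g\cdot x}$ by a complex linear map. Then the first Chern class of $L$ vanishes: $c_1(L)=0$. Here $c_1(L)\in H^2_{\mathrm{dR}}(\mathbb{T}^2;\mathbb{C})$ is the de Rham class of $\frac{i}{2\pi}F_\nabla$, where $F_\nabla$ is the curvature of an arbitrary smooth connection $\nabla$ on $L$ (the class does not depend on $\nabla$). -/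

import Mathlib

open scoped Manifold ContDiff Topology
open Bundle VectorField

noncomputable section

/-! ### Complex differential forms and de Rham cohomology in degree two

`M` is a smooth real manifold. A complex `k`-form is a family of real-multilinear alternating maps
`T_x M × ⋯ × T_x M → ℂ`, smooth in the sense that its values on smooth vector fields are smooth. -/

section DeRham

variable {E : Type*} [NormedAddCommGroup E] [NormedSpace ℝ E]
  {H : Type*} [TopologicalSpace H] (I : ModelWithCorners ℝ E H)
  (M : Type*) [TopologicalSpace M] [ChartedSpace H M]

variable {M} in
/-- The derivative `X(f)` of a complex valued function `f` along a vector field `X`. -/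
def dirDeriv (X : (x : M) → TangentSpace I x) (f : M → ℂ) : M → ℂ :=
  fun x ↦ mvfderiv I f x (X x)

variable {I M} in
theorem dirDeriv_zero (X : (x : M) → TangentSpace I x) : dirDeriv I X 0 = 0 := by
  funext x
  simp [dirDeriv]

variable {I M} in
theorem dirDeriv_add (X : (x : M) → TangentSpace I x) {f g : M → ℂ}
    (hf : ContMDiff I 𝓘(ℝ, ℂ) ∞ f) (hg : ContMDiff I 𝓘(ℝ, ℂ) ∞ g) :
    dirDeriv I X (f + g) = dirDeriv I X f + dirDeriv I X g := by
  funext x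
  simp [dirDeriv, mvfderiv_add ((hf x).mdifferentiableAt (by simp))
    ((hg x).mdifferentiableAt (by simp))]

variable {I M} in
theorem dirDeriv_smul (X : (x : M) → TangentSpace I x) (c : ℂ) {f : M → ℂ}
    (hf : ContMDiff I 𝓘(ℝ, ℂ) ∞ f) :
    dirDeriv I X (c • f) = c • dirDeriv I X f := by
  funext x
  have h := ((hf x).mdifferentiableAt (by simp)).hasMFDerivAt
  have h2 : HasMFDerivAt 𝓘(ℝ, ℂ) 𝓘(ℝ, ℂ) (c • ContinuousLinearMap.id ℝ ℂ) (f x)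
      (c • ContinuousLinearMap.id ℝ ℂ) :=
    (c • ContinuousLinearMap.id ℝ ℂ).hasMFDerivAt
  have h3 := (HasMFDerivAt.comp x h2 h).mfderiv
  have h4 : (⇑(c • ContinuousLinearMap.id ℝ ℂ) ∘ f) = c • f := rfl
  rw [h4] at h3
  simp only [dirDeriv, mvfderiv, h3]
  rfl

variable [IsManifold I ∞ M]

variable {M} in
/-- `X` is a smooth vector field on `M`. -/
def IsSmoothVectorField (X : (x : M) → TangentSpace I x) : Prop :=
  ContMDiff I I.tangent ∞ fun x ↦ (⟨x, X x⟩ : TangentBundle I M)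

/-- Complex valued `k`-forms on `M`, without any smoothness. -/
def FormField (k : ℕ) : Type _ := (x : M) → TangentSpace I x [⋀^Fin k]→L[ℝ] ℂ

instance (k : ℕ) : AddCommGroup (FormField I M k) :=
  inferInstanceAs (AddCommGroup ((x : M) → TangentSpace I x [⋀^Fin k]→L[ℝ] ℂ))

instance (k : ℕ) : Module ℂ (FormField I M k) :=
  inferInstanceAs (Module ℂ ((x : M) → TangentSpace I x [⋀^Fin k]→L[ℝ] ℂ))

/-- The space `Ω^k(M; ℂ)` of smooth complex valued `k`-forms. -/
def smoothForms (k : ℕ) :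
    Submodule ℂ (FormField I M k) where
  carrier := {σ | ∀ X : Fin k → (x : M) → TangentSpace I x, (∀ i, IsSmoothVectorField I (X i)) →
    ContMDiff I 𝓘(ℝ, ℂ) ∞ fun x ↦ σ x fun i ↦ X i x}
  zero_mem' _ _ := contMDiff_const
  add_mem' hσ hτ X hX := (hσ X hX).add (hτ X hX)
  smul_mem' c _ hσ X hX := 
    (c • ContinuousLinearMap.id ℝ ℂ).contMDiff.comp (hσ X hX)

variable {I M}

/-- The function `β(X)` for a `1`-form `β`. -/
def eval₁ (β : FormField I M 1)
    (X : (x : M) → TangentSpace I x) : M → ℂ :=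
  fun x ↦ β x ![X x]

/-- The function `η(X, Y)` for a `2`-form `η`. -/
def eval₂ (η : FormField I M 2)
    (X Y : (x : M) → TangentSpace I x) : M → ℂ :=
  fun x ↦ η x ![X x, Y x]

/-- `(dβ)(X, Y) = X(β(Y)) - Y(β(X)) - β([X, Y])` for a `1`-form `β`. -/
def extDeriv₁ (β : FormField I M 1)
    (X Y : (x : M) → TangentSpace I x) : M → ℂ :=
  dirDeriv I X (eval₁ β Y) - dirDeriv I Y (eval₁ β X) - eval₁ β (mlieBracket I X Y)

/-- `(dη)(X, Y, Z) = X(η(Y, Z)) - Y(η(X, Z)) + Z(η(X, Y)) - η([X, Y], Z) + η([X, Z], Y)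
- η([Y, Z], X)` for a `2`-form `η`. -/
def extDeriv₂ (η : FormField I M 2)
    (X Y Z : (x : M) → TangentSpace I x) : M → ℂ :=
  dirDeriv I X (eval₂ η Y Z) - dirDeriv I Y (eval₂ η X Z) + dirDeriv I Z (eval₂ η X Y)
    - eval₂ η (mlieBracket I X Y) Z + eval₂ η (mlieBracket I X Z) Y
    - eval₂ η (mlieBracket I Y Z) X

theorem contMDiff_eval₁ {β : FormField I M 1}
    (hβ : β ∈ smoothForms I M 1) {X : (x : M) → TangentSpace I x}
    (hX : IsSmoothVectorField I X) : ContMDiff I 𝓘(ℝ, ℂ) ∞ (eval₁ β X) := by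
  convert hβ ![X] (by simpa using hX) using 2 with x
  refine congrArg (β x) (funext fun i ↦ ?_)
  fin_cases i
  rfl

theorem contMDiff_eval₂ {η : FormField I M 2}
    (hη : η ∈ smoothForms I M 2) {X Y : (x : M) → TangentSpace I x}
    (hX : IsSmoothVectorField I X) (hY : IsSmoothVectorField I Y) :
    ContMDiff I 𝓘(ℝ, ℂ) ∞ (eval₂ η X Y) := by
  convert hη ![X, Y] (by intro i; fin_cases i <;> assumption) using 2 with x
  refine congrArg (η x) (funext fun i ↦ ?_)
  fin_cases i <;> rfl

variable (I M) in
/-- The space of closed smooth complex `2`-forms on `M`. -/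
def closedForms₂ : Submodule ℂ (smoothForms I M 2) where
  carrier := {η | ∀ X Y Z : (x : M) → TangentSpace I x, IsSmoothVectorField I X →
    IsSmoothVectorField I Y → IsSmoothVectorField I Z →
    extDeriv₂ (η : FormField I M 2) X Y Z = 0}
  zero_mem' X Y Z _ _ _ := by
    have h : ∀ X Y : (x : M) → TangentSpace I x, eval₂ (0 : FormField I M 2) X Y = 0 := fun _ _ ↦ rfl
    simp [extDeriv₂, h, dirDeriv_zero]
  add_mem' {η ζ} hη hζ X Y Z hX hY hZ := by
    have h : ∀ X Y : (x : M) → TangentSpace I x,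
      eval₂ (η.1 + ζ.1) X Y = eval₂ η.1 X Y + eval₂ ζ.1 X Y := fun _ _ ↦ rfl
    have h1 := hη X Y Z hX hY hZ
    have h2 := hζ X Y Z hX hY hZ
    simp only [extDeriv₂, Submodule.coe_add, h] at h1 h2 ⊢
    rw [dirDeriv_add _ (contMDiff_eval₂ η.2 hY hZ) (contMDiff_eval₂ ζ.2 hY hZ),
      dirDeriv_add _ (contMDiff_eval₂ η.2 hX hZ) (contMDiff_eval₂ ζ.2 hX hZ),
      dirDeriv_add _ (contMDiff_eval₂ η.2 hX hY) (contMDiff_eval₂ ζ.2 hX hY)]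
    linear_combination h1 + h2
  smul_mem' c η hη X Y Z hX hY hZ := by
    have h : ∀ X Y : (x : M) → TangentSpace I x,
      eval₂ (c • η.1) X Y = c • eval₂ η.1 X Y := fun _ _ ↦ rfl
    have h1 := hη X Y Z hX hY hZ
    simp only [extDeriv₂, Submodule.coe_smul, h] at h1 ⊢
    rw [dirDeriv_smul _ c (contMDiff_eval₂ η.2 hY hZ),
      dirDeriv_smul _ c (contMDiff_eval₂ η.2 hX hZ),
      dirDeriv_smul _ c (contMDiff_eval₂ η.2 hX hY)]
    simp only [← smul_sub, ← smul_add]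
    rw [h1, smul_zero]

variable (I M) in
/-- The space of exact smooth complex `2`-forms on `M`: those of the form `dβ` for a smooth
`1`-form `β`. -/
def exactForms₂ : Submodule ℂ (smoothForms I M 2) where
  carrier := {η | ∃ β : smoothForms I M 1, ∀ X Y : (x : M) → TangentSpace I x,
    IsSmoothVectorField I X → IsSmoothVectorField I Y →
    eval₂ (η : FormField I M 2) X Y =
      extDeriv₁ (β : FormField I M 1) X Y}
  zero_mem' := by
    refine ⟨0, fun X Y _ _ ↦ ?_⟩
    have h : ∀ X : (x : M) → TangentSpace I x, eval₁ (0 : FormField I M 1) X = 0 := fun _ ↦ rfl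
    simp only [extDeriv₁, Submodule.coe_zero, h, dirDeriv_zero, sub_zero]
    rfl
  add_mem' := by
    rintro η ζ ⟨β, hβ⟩ ⟨γ, hγ⟩
    refine ⟨β + γ, fun X Y hX hY ↦ ?_⟩
    have h : ∀ X Y : (x : M) → TangentSpace I x,
      eval₂ (η.1 + ζ.1) X Y = eval₂ η.1 X Y + eval₂ ζ.1 X Y := fun _ _ ↦ rfl
    have h' : ∀ X : (x : M) → TangentSpace I x,
      eval₁ (β.1 + γ.1) X = eval₁ β.1 X + eval₁ γ.1 X := fun _ ↦ rfl
    have h1 := hβ X Y hX hY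
    have h2 := hγ X Y hX hY
    simp only [extDeriv₁, Submodule.coe_add, h, h'] at h1 h2 ⊢
    rw [dirDeriv_add _ (contMDiff_eval₁ β.2 hX) (contMDiff_eval₁ γ.2 hX),
      dirDeriv_add _ (contMDiff_eval₁ β.2 hY) (contMDiff_eval₁ γ.2 hY)]
    linear_combination h1 + h2
  smul_mem' := by
    rintro c η ⟨β, hβ⟩
    refine ⟨c • β, fun X Y hX hY ↦ ?_⟩
    have h : ∀ X Y : (x : M) → TangentSpace I x,
      eval₂ (c • η.1) X Y = c • eval₂ η.1 X Y := fun _ _ ↦ rfl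
    have h' : ∀ X : (x : M) → TangentSpace I x,
      eval₁ (c • β.1) X = c • eval₁ β.1 X := fun _ ↦ rfl
    have h1 := hβ X Y hX hY
    simp only [extDeriv₁, Submodule.coe_smul, h, h'] at h1 ⊢
    rw [dirDeriv_smul _ c (contMDiff_eval₁ β.2 hX), dirDeriv_smul _ c (contMDiff_eval₁ β.2 hY), h1]
    simp only [← smul_sub]

variable (I M) in
/-- The de Rham cohomology `H²_dR(M; ℂ)`: closed `2`-forms modulo exact `2`-forms. -/
abbrev DeRhamH2 : Type _ :=
  closedForms₂ I M ⧸ (exactForms₂ I M).submoduleOf (closedForms₂ I M)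

end DeRham

/-! ### Connections on complex line bundles and the first Chern class

A smooth complex line bundle `L` over `M` is a family of complex vector spaces `L x` with the
structure of a topological complex vector bundle with fibre `ℂ` whose (complex linear)
coordinate changes are smooth as maps of the real manifold `M`. In Mathlib this reads
`[FiberBundle ℂ L] [VectorBundle ℂ ℂ L] [VectorBundle ℝ ℂ L] [ContMDiffVectorBundle ∞ ℂ L I]`;
the bundle atlas is the same in all four, and the third one follows from the second. The classes
`[∀ x, IsTopologicalAddGroup (L x)] [∀ x, ContinuousSMul ℝ (L x)]`, which Mathlib's covariant
derivatives ask for, are consequences of the vector bundle structure as well. -/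

section Chern

variable {E : Type*} [NormedAddCommGroup E] [NormedSpace ℝ E]
  {H : Type*} [TopologicalSpace H] (I : ModelWithCorners ℝ E H)
  {M : Type*} [TopologicalSpace M] [ChartedSpace H M] [IsManifold I ∞ M]
  (L : M → Type*) [∀ x, AddCommGroup (L x)] [∀ x, Module ℂ (L x)] [∀ x, TopologicalSpace (L x)]
  [∀ x, IsTopologicalAddGroup (L x)] [∀ x, ContinuousSMul ℝ (L x)]
  [TopologicalSpace (TotalSpace ℂ L)] [FiberBundle ℂ L]

variable {L} in
/-- `s` is a smooth section of `L`. -/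
def IsSmoothSection (s : (x : M) → L x) : Prop :=
  ContMDiff I (I.prod 𝓘(ℝ, ℂ)) ∞ fun x ↦ TotalSpace.mk' ℂ x (s x)

/-- A smooth connection on the complex line bundle `L`: a covariant derivative `∇` which is complex
linear in the section and for which `∇_X s` is smooth whenever `X` and `s` are. (Together with the
Leibniz rule for real functions, complex linearity gives the one for complex functions.) -/
structure ComplexConnection extends CovariantDerivative I ℂ L where
  map_smul' : ∀ (c : ℂ) (s : (x : M) → L x) (x : M),
    MDifferentiableAt I (I.prod 𝓘(ℝ, ℂ)) (fun y ↦ TotalSpace.mk' ℂ y (s y)) x →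
    ∀ v : TangentSpace I x, toFun (c • s) x v = c • toFun s x v
  smooth' : ∀ (X : (x : M) → TangentSpace I x) (s : (x : M) → L x),
    IsSmoothVectorField I X → IsSmoothSection I s → IsSmoothSection I fun x ↦ toFun s x (X x)

variable {I L}

/-- The section `∇_X s`. -/
def ComplexConnection.deriv (D : ComplexConnection I L) (X : (x : M) → TangentSpace I x)
    (s : (x : M) → L x) : (x : M) → L x :=
  fun x ↦ D.toFun s x (X x)

/-- The curvature `F(X, Y) s = ∇_X ∇_Y s - ∇_Y ∇_X s - ∇_[X, Y] s`. -/
def ComplexConnection.curvature (D : ComplexConnection I L) (X Y : (x : M) → TangentSpace I x)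
    (s : (x : M) → L x) : (x : M) → L x :=
  D.deriv X (D.deriv Y s) - D.deriv Y (D.deriv X s) - D.deriv (mlieBracket I X Y) s

/-- `η` is the Chern form `(i / 2π) F` of the connection, i.e.
`η(X, Y) s = (i / 2π) F(X, Y) s` for all smooth vector fields `X`, `Y` and smooth sections `s`.
(That the form is closed is the Bianchi identity.) -/
def ComplexConnection.IsChernForm (D : ComplexConnection I L) (η : closedForms₂ I M) : Prop :=
  ∀ X Y : (x : M) → TangentSpace I x, IsSmoothVectorField I X → IsSmoothVectorField I Y →
    ∀ s : (x : M) → L x, IsSmoothSection I s → ∀ x,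
      eval₂ (η : smoothForms I M 2).1 X Y x • s x =
        (Complex.I / (2 * Real.pi)) • D.curvature X Y s x

variable (I L) in
/-- `c` is the (de Rham) first Chern class `c₁(L)`: smooth connections on `L` with a Chern form
exist, and for each of them the Chern form represents `c`. There is at most one such `c`. -/
def IsFirstChernClass (c : DeRhamH2 I M) : Prop :=
  (∃ (D : ComplexConnection I L) (η : closedForms₂ I M), D.IsChernForm η) ∧
    ∀ (D : ComplexConnection I L) (η : closedForms₂ I M), D.IsChernForm η →
      Submodule.Quotient.mk η = c

theorem IsFirstChernClass.unique {c c' : DeRhamH2 I M} (h : IsFirstChernClass I L c)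
    (h' : IsFirstChernClass I L c') : c = c' := by
  obtain ⟨D, η, hη⟩ := h.1
  exact (h.2 D η hη).symm.trans (h'.2 D η hη)

end Chern

/-! ### Equivariant line bundles -/

section Equivariant

variable (V : Type*) [NormedAddCommGroup V] [NormedSpace ℝ V]
  {E : Type*} [NormedAddCommGroup E] [NormedSpace ℝ E]
  {H : Type*} [TopologicalSpace H] (I : ModelWithCorners ℝ E H)
  {M : Type*} [TopologicalSpace M] [ChartedSpace H M] [AddAction V M]
  (L : M → Type*) [∀ x, AddCommGroup (L x)] [∀ x, Module ℂ (L x)] [∀ x, TopologicalSpace (L x)]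
  [TopologicalSpace (TotalSpace ℂ L)] [FiberBundle ℂ L] [AddAction V (TotalSpace ℂ L)]

/-- The given actions of the vector group `V` on `M` and on the total space of the line bundle `L`
make `L` a `V`-equivariant line bundle: `V` acts smoothly on `L`, the projection is equivariant,
and `V` acts by complex linear maps between the fibres. -/
structure IsEquivariantLineBundle : Prop where
  smooth : ContMDiff (𝓘(ℝ, V).prod (I.prod 𝓘(ℝ, ℂ))) (I.prod 𝓘(ℝ, ℂ)) ∞
    fun p : V × TotalSpace ℂ L ↦ p.1 +ᵥ p.2
  proj_vadd : ∀ (g : V) (p : TotalSpace ℂ L), (g +ᵥ p).proj = g +ᵥ p.proj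
  linear : ∀ (g : V) (x : M), ∃ A : L x →ₗ[ℂ] L (g +ᵥ x),
    ∀ v : L x, g +ᵥ TotalSpace.mk' ℂ x v = TotalSpace.mk' ℂ (g +ᵥ x) (A v)

end Equivariant

/-! ### The torus `ℝ² / ℤ²` -/

/-- The plane `ℝ²`. -/
abbrev Plane : Type := EuclideanSpace ℝ (Fin 2)

/-- The subgroup `ℤ²` of `ℝ²`. -/
def intLattice : AddSubgroup Plane where
  carrier := {v | ∀ i, ∃ n : ℤ, v i = n}
  zero_mem' i := ⟨0, by simp⟩
  add_mem' {v w} hv hw i := by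
    obtain ⟨m, hm⟩ := hv i
    obtain ⟨n, hn⟩ := hw i
    exact ⟨m + n, by simp [hm, hn]⟩
  neg_mem' {v} hv i := by
    obtain ⟨m, hm⟩ := hv i
    exact ⟨-m, by simp [hm]⟩

theorem intLattice_eq_zero {v : Plane} (hv : v ∈ intLattice) (h : ‖v‖ < 1) : v = 0 := by
  ext i
  obtain ⟨n, hn⟩ := hv i
  have h1 : ‖v i‖ < 1 := (PiLp.norm_apply_le v i).trans_lt h
  rw [hn, Real.norm_eq_abs] at h1
  have h2 : |n| < 1 := by exact_mod_cast h1
  rw [hn, Int.abs_lt_one_iff.mp h2]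
  simp

theorem isDiscrete_intLattice : IsDiscrete (intLattice : Set Plane) := by
  refine ⟨?_⟩
  rw [discreteTopology_subtype_iff']
  intro v hv
  refine ⟨Metric.ball v 1, Metric.isOpen_ball, ?_⟩
  ext w
  simp only [Set.mem_inter_iff, Metric.mem_ball, SetLike.mem_coe, Set.mem_singleton_iff]
  constructor
  · rintro ⟨h, hw⟩
    have := intLattice_eq_zero (intLattice.sub_mem hw hv) (by rwa [← dist_eq_norm])
    exact sub_eq_zero.mp this
  · rintro rfl
    exact ⟨by simp, hv⟩

/-- The torus `𝕋² = ℝ² / ℤ²`. The group `ℝ²` acts on it by translations,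
`v +ᵥ [w] = [v + w]`. -/
abbrev Torus : Type := Plane ⧸ intLattice

theorem Torus.isLocalHomeomorph_mk :
    IsLocalHomeomorph (QuotientAddGroup.mk : Plane → Torus) :=
  (AddSubgroup.isAddQuotientCoveringMap_of_comm intLattice
    isDiscrete_intLattice).isCoveringMap.isLocalHomeomorph

/-- The charts of the torus are the local inverses of the projection `ℝ² → 𝕋²`. -/
instance : ChartedSpace Plane Torus :=
  Torus.isLocalHomeomorph_mk.chartedSpace QuotientAddGroup.mk_surjective

theorem Torus.mk_chart {e : OpenPartialHomeomorph Torus Plane} (he : e ∈ atlas Plane Torus)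
    {q : Torus} (hq : q ∈ e.source) : QuotientAddGroup.mk (e q) = q := by
  obtain ⟨p, rfl⟩ := he
  simp only [chartAt_self_eq, OpenPartialHomeomorph.trans_refl] at hq ⊢
  exact Torus.isLocalHomeomorph_mk.apply_localInverseAt_of_mem hq

theorem Torus.chart_symm {e : OpenPartialHomeomorph Torus Plane} (he : e ∈ atlas Plane Torus)
    {v : Plane} (hv : v ∈ e.target) : e.symm v = QuotientAddGroup.mk v := by
  have := Torus.mk_chart he (e.map_target hv)
  rw [e.right_inv hv] at this
  exact this.symm

instance : IsManifold 𝓘(ℝ, Plane) ∞ Torus := by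
  refine isManifold_of_contDiffOn _ _ _ fun e e' he he' ↦ ?_
  simp only [modelWithCornersSelf_coe, modelWithCornersSelf_coe_symm, Function.comp_id,
    Function.id_comp, Set.range_id, Set.inter_univ, Set.preimage_id]
  have key : ∀ v ∈ (e.symm.trans e').source, (e.symm.trans e') v - v ∈ intLattice := by
    intro v hv
    have hv' := hv
    rw [OpenPartialHomeomorph.trans_source] at hv'
    have h := Torus.mk_chart he' hv'.2
    rw [Torus.chart_symm he hv'.1] at h
    rw [← neg_add_eq_sub, ← QuotientAddGroup.eq, eq_comm]
    simpa [Torus.chart_symm he hv'.1] using h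
  intro v hv
  have hc : ContinuousAt (fun w ↦ (e.symm.trans e') w - w) v :=
    ((e.symm.trans e').continuousAt hv).sub continuousAt_id
  have hev : ∀ᶠ w in 𝓝 v, (e.symm.trans e') w = w + ((e.symm.trans e') v - v) := by
    filter_upwards [Metric.continuousAt_iff'.mp hc 1 one_pos,
      (e.symm.trans e').open_source.mem_nhds hv] with w hw hws
    have := intLattice_eq_zero (intLattice.sub_mem (key w hws) (key v hv))
      (by rwa [← dist_eq_norm])
    rw [← sub_eq_zero.mp this]
    abel
  exact ((contDiffAt_id.add contDiffAt_const).congr_of_eventuallyEq hev).contDiffWithinAt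

end

/-! The line bundle turns out to be trivial. Fix a nonzero vector `v` over the base point. Its orbit
`t +ᵥ v` is a nowhere zero section of the pullback to the plane. It need not descend: a lattice
generator `e i` acts on the base fibre as multiplication by some nonzero number `exp (a i)`
(`exists_holonomy`). Since the acting group is the whole plane, this holonomy can be undone
continuously: multiplying the orbit by `exp (-∑ t i * a i)` makes it periodic, and it descends to a
smooth global frame `σ` (`exists_frame`).

A global frame settles both halves of `IsFirstChernClass`. For any connection, `∇σ = β ⊗ σ` with `β`
a global form, the curvature is `dβ`, and so every Chern form is exact
(`IsChernForm.mem_exactForms₂`). The existence half comes from the connection that makes `σ`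
parallel: it is flat, and `0` is a Chern form for it (`flatConnection_curvature`). -/

noncomputable section

/-! ### Calculus on the torus through its universal cover -/

section TorusCalculus

namespace Torus

/-- The universal covering of the torus. -/
abbrev cover : Plane → Torus := QuotientAddGroup.mk

theorem isLocalDiffeomorph_cover :
    IsLocalDiffeomorph 𝓘(ℝ, Plane) 𝓘(ℝ, Plane) ∞ cover := by
  intro t
  set e := chartAt Plane (cover t)
  have he : e ∈ IsManifold.maximalAtlas 𝓘(ℝ, Plane) ∞ Torus :=
    IsManifold.chart_mem_maximalAtlas _
  have hsrc : e (cover t) ∈ e.target := e.map_source (mem_chart_source _ _)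
  have h1 : IsLocalDiffeomorphAt 𝓘(ℝ, Plane) 𝓘(ℝ, Plane) ∞ cover (e (cover t)) :=
    ⟨{ toPartialEquiv := e.symm.toPartialEquiv
       open_source := e.open_target
       open_target := e.open_source
       contMDiffOn_toFun := contMDiffOn_symm_of_mem_maximalAtlas he
       contMDiffOn_invFun := contMDiffOn_of_mem_maximalAtlas he }, hsrc,
      fun v hv ↦ (chart_symm (chart_mem_atlas _ _) hv).symm⟩
  -- The inverse chart agrees with `cover` near `e (cover t)`, which may be a different lift of
  -- `cover t` than `t`. The two lifts differ by a lattice vector, and translation by it leaves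
  -- `cover` unchanged.
  let n : Plane := e (cover t) - t
  have hn : n ∈ intLattice := by
    have h := mk_chart (chart_mem_atlas Plane (cover t)) (mem_chart_source Plane (cover t))
    have h' := QuotientAddGroup.eq.1 h.symm
    rwa [neg_add_eq_sub] at h'
  let τ : Plane ≃ₘ^∞⟮𝓘(ℝ, Plane), 𝓘(ℝ, Plane)⟯ Plane :=
    { toEquiv := Equiv.addRight n
      contMDiff_toFun := (contDiff_id.add contDiff_const).contMDiff
      contMDiff_invFun := (contDiff_id.add contDiff_const).contMDiff }
  have h2 : IsLocalDiffeomorphAt 𝓘(ℝ, Plane) 𝓘(ℝ, Plane) ∞ τ t := τ.isLocalDiffeomorph t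
  have ht : τ t = e (cover t) := add_sub_cancel t (e (cover t))
  have h3 := h2.comp 𝓘(ℝ, Plane) Torus (ht ▸ h1 : IsLocalDiffeomorphAt 𝓘(ℝ, Plane) 𝓘(ℝ, Plane) ∞ cover (τ t))
  have h4 : cover ∘ τ = cover := funext fun v ↦ QuotientAddGroup.mk_add_of_mem v hn
  rwa [h4] at h3

theorem contMDiff_cover : ContMDiff 𝓘(ℝ, Plane) 𝓘(ℝ, Plane) ∞ cover :=
  isLocalDiffeomorph_cover.contMDiff

theorem isInvertible_mfderiv_cover (t : Plane) :
    (mfderiv 𝓘(ℝ, Plane) 𝓘(ℝ, Plane) cover t).IsInvertible :=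
  ⟨_, isLocalDiffeomorph_cover.mfderivToContinuousLinearEquiv_coe (x := t) (by simp)⟩

/-- A map on the torus is smooth if its lift to the plane is. -/
theorem contMDiff_of_comp_cover {E' : Type*} [NormedAddCommGroup E'] [NormedSpace ℝ E']
    {H' : Type*} [TopologicalSpace H'] {J : ModelWithCorners ℝ E' H'}
    {N : Type*} [TopologicalSpace N] [ChartedSpace H' N] {g : Torus → N}
    (hg : ContMDiff 𝓘(ℝ, Plane) J ∞ (g ∘ cover)) : ContMDiff 𝓘(ℝ, Plane) J ∞ g := by
  intro q
  obtain ⟨t, rfl⟩ := QuotientAddGroup.mk_surjective q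
  have h := isLocalDiffeomorph_cover t
  refine (hg.contMDiffAt.comp (cover t) h.localInverse_contMDiffAt).congr_of_eventuallyEq ?_
  filter_upwards [h.localInverse_eventuallyEq_right] with y hy
  exact congrArg g hy.symm

/-- The lift of a vector field on the torus to the plane. -/
def liftField (X : (x : Torus) → TangentSpace 𝓘(ℝ, Plane) x) : Plane → Plane :=
  mpullback 𝓘(ℝ, Plane) 𝓘(ℝ, Plane) cover X

theorem contDiff_liftField {X : (x : Torus) → TangentSpace 𝓘(ℝ, Plane) x}
    (hX : IsSmoothVectorField 𝓘(ℝ, Plane) X) : ContDiff ℝ ∞ (liftField X) :=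
  contMDiff_vectorSpace_iff_contDiff.1 <|
    ContMDiff.mpullback_vectorField hX contMDiff_cover isInvertible_mfderiv_cover le_rfl

theorem contDiff_comp_cover {g : Torus → ℂ} (hg : ContMDiff 𝓘(ℝ, Plane) 𝓘(ℝ, ℂ) ∞ g) :
    ContDiff ℝ ∞ (g ∘ cover) :=
  (hg.comp contMDiff_cover).contDiff

/-- Chain rule for `cover`. It turns calculus on the torus into ordinary Fréchet derivatives on the
plane. -/
theorem dirDeriv_cover (X : (x : Torus) → TangentSpace 𝓘(ℝ, Plane) x) {g : Torus → ℂ}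
    (hg : ContMDiff 𝓘(ℝ, Plane) 𝓘(ℝ, ℂ) ∞ g) :
    dirDeriv 𝓘(ℝ, Plane) X g ∘ cover = fun t ↦ fderiv ℝ (g ∘ cover) t (liftField X t) := by
  funext t
  have h1 : mfderiv 𝓘(ℝ, Plane) 𝓘(ℝ, Plane) cover t (liftField X t) = X (cover t) := by
    rw [liftField, mpullback_apply]
    exact (isInvertible_mfderiv_cover t).self_apply_inverse _
  have h2 := mfderiv_comp_apply t ((hg (cover t)).mdifferentiableAt (by simp))
    (contMDiff_cover.mdifferentiableAt (by simp) (x := t)) (liftField X t)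
  rw [h1, mfderiv_eq_fderiv] at h2
  exact h2.symm

theorem contMDiff_dirDeriv {X : (x : Torus) → TangentSpace 𝓘(ℝ, Plane) x}
    (hX : IsSmoothVectorField 𝓘(ℝ, Plane) X) {g : Torus → ℂ}
    (hg : ContMDiff 𝓘(ℝ, Plane) 𝓘(ℝ, ℂ) ∞ g) :
    ContMDiff 𝓘(ℝ, Plane) 𝓘(ℝ, ℂ) ∞ (dirDeriv 𝓘(ℝ, Plane) X g) := by
  apply contMDiff_of_comp_cover
  rw [dirDeriv_cover X hg]
  exact (((contDiff_comp_cover hg).fderiv_right (by simp)).clm_apply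
    (contDiff_liftField hX)).contMDiff

/-- The Lie bracket of vector fields acts on functions as the commutator. -/
theorem dirDeriv_mlieBracket {X Y : (x : Torus) → TangentSpace 𝓘(ℝ, Plane) x}
    (hX : IsSmoothVectorField 𝓘(ℝ, Plane) X) (hY : IsSmoothVectorField 𝓘(ℝ, Plane) Y)
    {g : Torus → ℂ} (hg : ContMDiff 𝓘(ℝ, Plane) 𝓘(ℝ, ℂ) ∞ g) :
    dirDeriv 𝓘(ℝ, Plane) (mlieBracket 𝓘(ℝ, Plane) X Y) g =
      dirDeriv 𝓘(ℝ, Plane) X (dirDeriv 𝓘(ℝ, Plane) Y g) -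
        dirDeriv 𝓘(ℝ, Plane) Y (dirDeriv 𝓘(ℝ, Plane) X g) := by
  funext q
  obtain ⟨t, rfl⟩ := QuotientAddGroup.mk_surjective q
  -- Pullback along a local diffeomorphism commutes with brackets, so the claim moves to the plane,
  -- where it amounts to symmetry of the second derivative.
  have hb : liftField (mlieBracket 𝓘(ℝ, Plane) X Y) t =
      lieBracket ℝ (liftField X) (liftField Y) t := by
    have : IsManifold 𝓘(ℝ, Plane) (minSmoothness ℝ 2) Torus := by
      rw [minSmoothness_of_isRCLikeNormedField]
      exact IsManifold.of_le (n := ∞) ENat.LEInfty.out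
    rw [liftField, mpullback_mlieBracket (n := ∞) ((hX _).mdifferentiableAt (by simp))
      ((hY _).mdifferentiableAt (by simp)) contMDiff_cover.contMDiffAt
      (by simpa using ENat.LEInfty.out),
      ← mlieBracketWithin_univ, mlieBracketWithin_eq_lieBracketWithin]
    exact congrFun lieBracketWithin_univ t
  have e1 := congrFun (dirDeriv_cover (mlieBracket 𝓘(ℝ, Plane) X Y) hg) t
  have e2 := congrFun (dirDeriv_cover X (contMDiff_dirDeriv hY hg)) t
  have e3 := congrFun (dirDeriv_cover Y (contMDiff_dirDeriv hX hg)) t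
  rw [dirDeriv_cover _ hg] at e2 e3
  simp only [Function.comp_apply] at e1 e2 e3
  rw [Pi.sub_apply, e1, e2, e3, hb]
  exact fderiv_apply_lieBracket (n := ∞) (contDiff_comp_cover hg).contDiffAt
    (by simpa using ENat.LEInfty.out)
    ((contDiff_liftField hY).differentiable (by simp) t)
    ((contDiff_liftField hX).differentiable (by simp) t)

end Torus

end TorusCalculus

/-! ### Line bundles with a global frame -/

section Frame

variable {E : Type*} [NormedAddCommGroup E] [NormedSpace ℝ E]
  {H : Type*} [TopologicalSpace H] {I : ModelWithCorners ℝ E H}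
  {M : Type*} [TopologicalSpace M] [ChartedSpace H M]

theorem contMDiffAt_complex_mul {f g : M → ℂ} {x : M} (hf : ContMDiffAt I 𝓘(ℝ, ℂ) ∞ f x)
    (hg : ContMDiffAt I 𝓘(ℝ, ℂ) ∞ g x) : ContMDiffAt I 𝓘(ℝ, ℂ) ∞ (fun y ↦ f y * g y) x :=
  (contDiff_mul (𝕜 := ℝ) (𝔸 := ℂ)).contMDiff.contMDiffAt.comp x (hf.prodMk_space hg)

variable {L : M → Type*} [∀ x, AddCommGroup (L x)] [∀ x, Module ℂ (L x)] [∀ x, TopologicalSpace (L x)]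
  [TopologicalSpace (TotalSpace ℂ L)] [FiberBundle ℂ L] [VectorBundle ℂ ℂ L]

/-- The coordinate on the fibre over `x` with respect to the value at `x` of a frame `σ`. -/
def frameCoord (σ : (x : M) → L x) (x : M) : L x →L[ℂ] ℂ :=
  ((trivializationAt ℂ L x).continuousLinearMapAt ℂ x (σ x))⁻¹ •
    (trivializationAt ℂ L x).continuousLinearMapAt ℂ x

theorem continuousLinearMapAt_ne_zero {x y : M} (hy : y ∈ (trivializationAt ℂ L x).baseSet)
    {v : L y} (hv : v ≠ 0) : (trivializationAt ℂ L x).continuousLinearMapAt ℂ y v ≠ 0 := by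
  intro h
  apply hv
  rw [← (trivializationAt ℂ L x).symmL_continuousLinearMapAt (R := ℂ) hy v, h, map_zero]

theorem frameCoord_smul {σ : (x : M) → L x} {x : M} (hσ : σ x ≠ 0) (c : ℂ) :
    frameCoord σ x (c • σ x) = c := by
  have h := continuousLinearMapAt_ne_zero (mem_baseSet_trivializationAt ℂ L x) hσ
  rw [frameCoord, smul_apply, map_smul, smul_eq_mul, smul_eq_mul]
  field_simp

theorem frameCoord_smul_frame {σ : (x : M) → L x} {x : M} (hσ : σ x ≠ 0) (v : L x) :
    frameCoord σ x v • σ x = v := by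
  have hx := mem_baseSet_trivializationAt ℂ L x
  have h := continuousLinearMapAt_ne_zero hx hσ
  rw [← (trivializationAt ℂ L x).symmL_continuousLinearMapAt (R := ℂ) hx (frameCoord σ x v • σ x),
    map_smul, frameCoord, smul_apply, smul_eq_mul, smul_eq_mul,
    inv_mul_eq_div, div_mul_cancel₀ _ h, Trivialization.symmL_continuousLinearMapAt _ hx]

theorem smul_frame_injective {σ : (x : M) → L x} {x : M} (hσ : σ x ≠ 0) {a b : ℂ}
    (h : a • σ x = b • σ x) : a = b := by
  rw [← frameCoord_smul hσ a, h, frameCoord_smul hσ]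

/-- In a trivialization around `x₀`, the coordinate of a section with respect to a frame is the
quotient of their representatives. -/
theorem frameCoord_eventuallyEq {σ : (x : M) → L x} (hσ : ∀ x, σ x ≠ 0) (s : (x : M) → L x)
    (x₀ : M) : (fun x ↦ frameCoord σ x (s x)) =ᶠ[𝓝 x₀]
      fun x ↦ (trivializationAt ℂ L x₀ ⟨x, s x⟩).2 * ((trivializationAt ℂ L x₀ ⟨x, σ x⟩).2)⁻¹ := by
  filter_upwards [(trivializationAt ℂ L x₀).open_baseSet.mem_nhds
    (mem_baseSet_trivializationAt ℂ L x₀)] with x hx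
  have h := continuousLinearMapAt_ne_zero hx (hσ x)
  rw [← Trivialization.continuousLinearMapAt_apply_of_mem (R := ℂ) _ hx,
    ← Trivialization.continuousLinearMapAt_apply_of_mem (R := ℂ) _ hx]
  conv_rhs => rw [← frameCoord_smul_frame (hσ x) (s x), map_smul, smul_eq_mul]
  field_simp

theorem trivialization_frame_ne_zero {σ : (x : M) → L x} {x : M} (hσ : σ x ≠ 0) :
    (trivializationAt ℂ L x ⟨x, σ x⟩).2 ≠ 0 := by
  have hx := mem_baseSet_trivializationAt ℂ L x
  rw [← Trivialization.continuousLinearMapAt_apply_of_mem (R := ℂ) _ hx]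
  exact continuousLinearMapAt_ne_zero hx hσ

/-- `frameCoord` uses a different trivialization at each point, so smoothness is checked after
passing to one fixed trivialization near `x`, where the coordinate is a quotient of smooth
functions. -/
theorem contMDiff_frameCoord {σ : (x : M) → L x} (hσ : ∀ x, σ x ≠ 0)
    (hσs : IsSmoothSection I σ) {s : (x : M) → L x} (hs : IsSmoothSection I s) :
    ContMDiff I 𝓘(ℝ, ℂ) ∞ fun x ↦ frameCoord σ x (s x) := by
  intro x
  refine ContMDiffAt.congr_of_eventuallyEq ?_ (frameCoord_eventuallyEq hσ s x)
  exact contMDiffAt_complex_mul ((contMDiffAt_section x).1 (hs x)) (ContMDiffAt.comp x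
    (contDiffAt_inv ℝ (trivialization_frame_ne_zero (hσ x))).contMDiffAt
    ((contMDiffAt_section x).1 (hσs x)))

/-- Pointwise version: the axioms of a covariant derivative concern sections differentiable at a
single point only. -/
theorem mdifferentiableAt_frameCoord {σ : (x : M) → L x} (hσ : ∀ x, σ x ≠ 0)
    (hσs : IsSmoothSection I σ) {s : (x : M) → L x} {x : M}
    (hs : MDifferentiableAt I (I.prod 𝓘(ℝ, ℂ)) (fun y ↦ TotalSpace.mk' ℂ y (s y)) x) :
    MDifferentiableAt I 𝓘(ℝ, ℂ) (fun x ↦ frameCoord σ x (s x)) x := by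
  refine MDifferentiableAt.congr_of_eventuallyEq ?_ (frameCoord_eventuallyEq hσ s x)
  exact ((mdifferentiableAt_section I s).1 hs).mul (MDifferentiableAt.comp x
    ((contDiffAt_inv (n := ∞) ℝ
      (trivialization_frame_ne_zero (hσ x))).contMDiffAt.mdifferentiableAt (by simp))
    ((mdifferentiableAt_section I σ).1 ((hσs x).mdifferentiableAt (by simp))))

theorem mdifferentiableAt_const_smul {s : (x : M) → L x} {x : M}
    (hs : MDifferentiableAt I (I.prod 𝓘(ℝ, ℂ)) (fun y ↦ TotalSpace.mk' ℂ y (s y)) x) (c : ℂ) :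
    MDifferentiableAt I (I.prod 𝓘(ℝ, ℂ)) (fun y ↦ TotalSpace.mk' ℂ y ((c • s) y)) x := by
  refine (mdifferentiableAt_section I _).2 (MDifferentiableAt.congr_of_eventuallyEq
    ((mdifferentiableAt_const (c := c)).mul ((mdifferentiableAt_section I s).1 hs)) ?_)
  filter_upwards [(trivializationAt ℂ L x).open_baseSet.mem_nhds
    (mem_baseSet_trivializationAt ℂ L x)] with y hy
  rw [← Trivialization.continuousLinearMapAt_apply_of_mem (R := ℂ) _ hy, Pi.smul_apply, map_smul,
    Trivialization.continuousLinearMapAt_apply_of_mem (R := ℂ) _ hy]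
  rfl

theorem isSmoothSection_smul {σ : (x : M) → L x} (hσ : IsSmoothSection I σ) {g : M → ℂ}
    (hg : ContMDiff I 𝓘(ℝ, ℂ) ∞ g) : IsSmoothSection I fun x ↦ g x • σ x := by
  intro x
  rw [contMDiffAt_section]
  refine ContMDiffAt.congr_of_eventuallyEq
    (contMDiffAt_complex_mul (hg x) ((contMDiffAt_section x).1 (hσ x))) ?_
  filter_upwards [(trivializationAt ℂ L x).open_baseSet.mem_nhds
    (mem_baseSet_trivializationAt ℂ L x)] with y hy
  rw [← Trivialization.continuousLinearMapAt_apply_of_mem (R := ℂ) _ hy, map_smul,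
    Trivialization.continuousLinearMapAt_apply_of_mem (R := ℂ) _ hy]
  rfl

end Frame

/-! ### Connections on line bundles with a global frame -/

section FrameConnection

variable {E : Type*} [NormedAddCommGroup E] [NormedSpace ℝ E]
  {H : Type*} [TopologicalSpace H] {I : ModelWithCorners ℝ E H}
  {M : Type*} [TopologicalSpace M] [ChartedSpace H M] [IsManifold I ∞ M]
  {L : M → Type*} [∀ x, AddCommGroup (L x)] [∀ x, Module ℂ (L x)] [∀ x, TopologicalSpace (L x)]
  [∀ x, IsTopologicalAddGroup (L x)] [∀ x, ContinuousSMul ℝ (L x)]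
  [TopologicalSpace (TotalSpace ℂ L)] [FiberBundle ℂ L]

/-- The Leibniz rule of a complex connection for complex valued functions. -/
theorem ComplexConnection.leibniz [VectorBundle ℂ ℂ L] [VectorBundle ℝ ℂ L] (D : ComplexConnection I L) {f : M → ℂ}
    {s : (x : M) → L x} {x : M} (hf : MDifferentiableAt I 𝓘(ℝ, ℂ) f x)
    (hs : MDifferentiableAt I (I.prod 𝓘(ℝ, ℂ)) (fun y ↦ TotalSpace.mk' ℂ y (s y)) x)
    (v : TangentSpace I x) :
    D.toFun (fun y ↦ f y • s y) x v = f x • D.toFun s x v + mvfderiv I f x v • s x := by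
  have hre : HasMFDerivAt I 𝓘(ℝ, ℝ) (fun y ↦ (f y).re) x
      (Complex.reCLM ∘L mfderiv I 𝓘(ℝ, ℂ) f x) :=
    Complex.reCLM.hasMFDerivAt.comp x hf.hasMFDerivAt
  have him : HasMFDerivAt I 𝓘(ℝ, ℝ) (fun y ↦ (f y).im) x
      (Complex.imCLM ∘L mfderiv I 𝓘(ℝ, ℂ) f x) :=
    Complex.imCLM.hasMFDerivAt.comp x hf.hasMFDerivAt
  have hsre := hre.mdifferentiableAt.smul_section hs
  have hsim := him.mdifferentiableAt.smul_section hs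
  have hsim' : MDifferentiableAt I (I.prod 𝓘(ℝ, ℂ)) (fun y ↦ TotalSpace.mk' ℂ y
      ((Complex.I • ((fun y ↦ (f y).im) • s)) y)) x :=
    mdifferentiableAt_const_smul hsim Complex.I
  -- The axioms give the Leibniz rule for real functions and complex linearity, so `f` is split into
  -- real and imaginary parts.
  have hdec : (fun y ↦ f y • s y) =
      (fun y ↦ (f y).re) • s + Complex.I • ((fun y ↦ (f y).im) • s) := by
    funext y
    simp only [Pi.add_apply, Pi.smul_apply', Pi.smul_apply]
    conv_lhs => rw [← Complex.re_add_im (f y), add_smul, mul_comm, mul_smul]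
    rfl
  have hD := D.isCovariantDerivativeOnUniv
  rw [hdec, hD.add hsre hsim', hD.leibniz hs hre.mdifferentiableAt]
  change ((f x).re • D.toFun s x v + mvfderiv I (fun y ↦ (f y).re) x v • s x) +
    D.toFun (Complex.I • _) x v = _
  rw [D.map_smul' Complex.I _ x hsim, hD.leibniz hs him.mdifferentiableAt]
  have e1 : mvfderiv I (fun y ↦ (f y).re) x v = (mvfderiv I f x v).re := by
    rw [mvfderiv, hre.mfderiv]; rfl
  have e2 : mvfderiv I (fun y ↦ (f y).im) x v = (mvfderiv I f x v).im := by
    rw [mvfderiv, him.mfderiv]; rfl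
  simp only [add_apply, smul_apply,
    ContinuousLinearMap.smulRight_apply, e1, e2]
  conv_rhs => rw [← Complex.re_add_im (f x), ← Complex.re_add_im (mvfderiv I f x v)]
  have h : ∀ (r : ℝ) (w : L x), r • w = (r : ℂ) • w := fun _ _ ↦ rfl
  simp only [h]
  module

/-- The connection form of a connection with respect to a frame `σ`: `∇_v σ = β(v) σ`. -/
def ComplexConnection.frameForm [VectorBundle ℂ ℂ L] (D : ComplexConnection I L)
    (σ : (x : M) → L x) : FormField I M 1 :=
  fun x ↦ ContinuousAlternatingMap.ofSubsingleton ℝ (TangentSpace I x) ℂ (0 : Fin 1)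
    ((frameCoord σ x).restrictScalars ℝ ∘L D.toFun σ x)

variable [VectorBundle ℂ ℂ L]

theorem ComplexConnection.deriv_frame (D : ComplexConnection I L) {σ : (x : M) → L x}
    (hσ : ∀ x, σ x ≠ 0) (X : (x : M) → TangentSpace I x) :
    D.deriv X σ = fun x ↦ eval₁ (D.frameForm σ) X x • σ x :=
  funext fun x ↦ (frameCoord_smul_frame (hσ x) _).symm

theorem ComplexConnection.frameForm_mem_smoothForms (D : ComplexConnection I L)
    {σ : (x : M) → L x} (hσ : ∀ x, σ x ≠ 0) (hσs : IsSmoothSection I σ) :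
    D.frameForm σ ∈ smoothForms I M 1 :=
  fun X hX ↦ contMDiff_frameCoord hσ hσs (D.smooth' (X 0) σ (hX 0) hσs)

/-- With respect to a frame, the curvature is the derivative of the connection form. -/
theorem ComplexConnection.curvature_frame [VectorBundle ℝ ℂ L] (D : ComplexConnection I L)
    {σ : (x : M) → L x} (hσ : ∀ x, σ x ≠ 0) (hσs : IsSmoothSection I σ)
    {X Y : (x : M) → TangentSpace I x} (hX : IsSmoothVectorField I X)
    (hY : IsSmoothVectorField I Y) (x : M) :
    D.curvature X Y σ x = extDeriv₁ (D.frameForm σ) X Y x • σ x := by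
  -- The product `β(Y) β(X)` is symmetric in `X` and `Y` because the fibre is a line. It cancels in
  -- the commutator, so only `dβ` survives.
  have key : ∀ {X Y : (x : M) → TangentSpace I x}, IsSmoothVectorField I Y →
      D.deriv X (D.deriv Y σ) x = (eval₁ (D.frameForm σ) Y x * eval₁ (D.frameForm σ) X x +
        dirDeriv I X (eval₁ (D.frameForm σ) Y) x) • σ x := by
    intro X Y hY
    have h := contMDiff_eval₁ (D.frameForm_mem_smoothForms hσ hσs) hY
    rw [D.deriv_frame hσ Y, ComplexConnection.deriv,
      D.leibniz ((h x).mdifferentiableAt (by simp)) ((hσs x).mdifferentiableAt (by simp)),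
      add_smul, mul_smul, ← congrFun (D.deriv_frame hσ X) x]
    rfl
  simp only [ComplexConnection.curvature, Pi.sub_apply, key hX, key hY,
    D.deriv_frame hσ (mlieBracket I X Y), extDeriv₁]
  module

/-- The Chern form of a connection on a line bundle with a global frame is exact. -/
theorem ComplexConnection.IsChernForm.mem_exactForms₂ [VectorBundle ℝ ℂ L]
    {D : ComplexConnection I L} {η : closedForms₂ I M} (h : D.IsChernForm η)
    {σ : (x : M) → L x} (hσ : ∀ x, σ x ≠ 0) (hσs : IsSmoothSection I σ) :
    (η : smoothForms I M 2) ∈ exactForms₂ I M := by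
  set β : smoothForms I M 1 := ⟨D.frameForm σ, D.frameForm_mem_smoothForms hσ hσs⟩
  refine ⟨(Complex.I / (2 * Real.pi)) • β, fun X Y hX hY ↦ ?_⟩
  have h' : ∀ X : (x : M) → TangentSpace I x, eval₁ ((Complex.I / (2 * Real.pi)) • β.1) X =
    (Complex.I / (2 * Real.pi)) • eval₁ β.1 X := fun _ ↦ rfl
  have h1 : eval₂ (η : smoothForms I M 2).1 X Y =
      (Complex.I / (2 * Real.pi)) • extDeriv₁ β.1 X Y := by
    funext x
    -- Testing the Chern form on the single section `σ` determines it, as `σ` vanishes nowhere.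
    apply smul_frame_injective (hσ x)
    rw [h X Y hX hY σ hσs x, D.curvature_frame hσ hσs hX hY x, Pi.smul_apply, smul_eq_mul,
      mul_smul]
  rw [h1]
  simp only [extDeriv₁, Submodule.coe_smul, h']
  rw [dirDeriv_smul _ _ (contMDiff_eval₁ β.2 hX), dirDeriv_smul _ _ (contMDiff_eval₁ β.2 hY)]
  simp only [← smul_sub]

end FrameConnection

/-! ### The flat connection of a global frame on the torus -/

section FlatConnection

variable {L : Torus → Type*} [∀ x, AddCommGroup (L x)] [∀ x, Module ℂ (L x)]
  [∀ x, TopologicalSpace (L x)] [∀ x, IsTopologicalAddGroup (L x)] [∀ x, ContinuousSMul ℝ (L x)]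
  [TopologicalSpace (TotalSpace ℂ L)] [FiberBundle ℂ L] [VectorBundle ℂ ℂ L]

/-- The multiples of a vector, as a map which is continuous and real linear in the coefficient. -/
def spanCLM {V : Type*} [AddCommGroup V] [Module ℂ V] [TopologicalSpace V]
    [IsTopologicalAddGroup V] [ContinuousSMul ℝ V] (v : V) : ℂ →L[ℝ] V where
  toLinearMap := (LinearMap.toSpanSingleton ℂ V v).restrictScalars ℝ
  cont := LinearMap.continuous_of_finiteDimensional _

theorem spanCLM_apply {V : Type*} [AddCommGroup V] [Module ℂ V] [TopologicalSpace V]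
    [IsTopologicalAddGroup V] [ContinuousSMul ℝ V] (v : V) (c : ℂ) : spanCLM v c = c • v := rfl

/-- The connection for which a given global frame `σ` is parallel: `∇ (g σ) = dg ⊗ σ`. -/
def flatConnection (σ : (x : Torus) → L x) (hσ : ∀ x, σ x ≠ 0)
    (hσs : IsSmoothSection 𝓘(ℝ, Plane) σ) : ComplexConnection 𝓘(ℝ, Plane) L where
  toFun s x := spanCLM (σ x) ∘L mvfderiv 𝓘(ℝ, Plane) (fun y ↦ frameCoord σ y (s y)) x
  isCovariantDerivativeOnUniv :=
    { add := by
        intro s s' x hs hs' _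
        have h : (fun y ↦ frameCoord σ y ((s + s') y)) =
            (fun y ↦ frameCoord σ y (s y)) + fun y ↦ frameCoord σ y (s' y) :=
          funext fun y ↦ map_add _ _ _
        rw [h, mvfderiv_add (mdifferentiableAt_frameCoord hσ hσs hs)
          (mdifferentiableAt_frameCoord hσ hσs hs'), ContinuousLinearMap.comp_add]
      leibniz := by
        intro s g x hs hg _
        have h : (fun y ↦ frameCoord σ y ((g • s) y)) = g • fun y ↦ frameCoord σ y (s y) :=
          funext fun y ↦ ((frameCoord σ y).restrictScalars ℝ).map_smul _ _
        rw [h, mvfderiv_smul hg (mdifferentiableAt_frameCoord hσ hσs hs)]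
        ext v
        have h2 : ∀ r : ℝ, (r • frameCoord σ x (s x)) • σ x = r • s x := fun r ↦ by
          rw [smul_assoc, frameCoord_smul_frame (hσ x)]
        have h3 : ∀ (r : ℝ) (c : ℂ), (r • c) • σ x = r • c • σ x := fun r c ↦ smul_assoc _ _ _
        simp only [ContinuousLinearMap.comp_apply, add_apply, smul_apply, spanCLM_apply, add_smul,
          ContinuousLinearMap.smulRight_apply, h2, h3] }
  map_smul' c s x hs v := by
    have h : (fun y ↦ frameCoord σ y ((c • s) y)) = c • fun y ↦ frameCoord σ y (s y) :=
      funext fun y ↦ map_smul _ _ _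
    have h2 := ((c • ContinuousLinearMap.id ℝ ℂ).hasMFDerivAt.comp x
      (mdifferentiableAt_frameCoord hσ hσs hs).hasMFDerivAt).mfderiv
    have h3 : mvfderiv 𝓘(ℝ, Plane) (c • fun y ↦ frameCoord σ y (s y)) x v =
        c • mvfderiv 𝓘(ℝ, Plane) (fun y ↦ frameCoord σ y (s y)) x v := congrArg (· v) h2
    rw [h, ContinuousLinearMap.comp_apply, h3, ContinuousLinearMap.comp_apply, spanCLM_apply,
      spanCLM_apply, smul_assoc]
  smooth' X s hX hs :=
    -- `∇_X s` has coordinate `X(g)`, where `g` is the coordinate of `s`.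
    isSmoothSection_smul hσs (Torus.contMDiff_dirDeriv hX (contMDiff_frameCoord hσ hσs hs))

theorem flatConnection_deriv_smul {σ : (x : Torus) → L x} (hσ : ∀ x, σ x ≠ 0)
    (hσs : IsSmoothSection 𝓘(ℝ, Plane) σ) (X : (x : Torus) → TangentSpace 𝓘(ℝ, Plane) x)
    (g : Torus → ℂ) : (flatConnection σ hσ hσs).deriv X (fun x ↦ g x • σ x) =
      fun x ↦ dirDeriv 𝓘(ℝ, Plane) X g x • σ x := by
  have h : (fun y ↦ frameCoord σ y (g y • σ y)) = g := funext fun y ↦ frameCoord_smul (hσ y) _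
  funext x
  change mvfderiv 𝓘(ℝ, Plane) (fun y ↦ frameCoord σ y (g y • σ y)) x (X x) • σ x = _
  rw [h]
  rfl

/-- On `g σ` the connection only differentiates `g`, so the curvature measures the failure of `[X,
Y]` to act on functions as the commutator of `X` and `Y`. -/
theorem flatConnection_curvature {σ : (x : Torus) → L x} (hσ : ∀ x, σ x ≠ 0)
    (hσs : IsSmoothSection 𝓘(ℝ, Plane) σ) {X Y : (x : Torus) → TangentSpace 𝓘(ℝ, Plane) x}
    (hX : IsSmoothVectorField 𝓘(ℝ, Plane) X) (hY : IsSmoothVectorField 𝓘(ℝ, Plane) Y)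
    {s : (x : Torus) → L x} (hs : IsSmoothSection 𝓘(ℝ, Plane) s) :
    (flatConnection σ hσ hσs).curvature X Y s = 0 := by
  have hg := contMDiff_frameCoord hσ hσs hs
  obtain ⟨g, rfl⟩ : ∃ g : Torus → ℂ, s = fun x ↦ g x • σ x :=
    ⟨_, funext fun x ↦ (frameCoord_smul_frame (hσ x) (s x)).symm⟩
  simp only [frameCoord_smul (hσ _)] at hg
  simp only [ComplexConnection.curvature, flatConnection_deriv_smul,
    Torus.dirDeriv_mlieBracket hX hY hg]
  funext x
  simp only [Pi.sub_apply, Pi.zero_apply]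
  module

theorem isFirstChernClass_zero_of_frame [VectorBundle ℝ ℂ L] {σ : (x : Torus) → L x} (hσ : ∀ x, σ x ≠ 0)
    (hσs : IsSmoothSection 𝓘(ℝ, Plane) σ) : IsFirstChernClass 𝓘(ℝ, Plane) L 0 := by
  refine ⟨⟨flatConnection σ hσ hσs, 0, fun X Y hX hY s hs x ↦ ?_⟩, fun D η h ↦ ?_⟩
  · rw [flatConnection_curvature hσ hσs hX hY hs, Pi.zero_apply, smul_zero]
    exact zero_smul ℂ (s x)
  · exact (Submodule.Quotient.mk_eq_zero _).2 (h.mem_exactForms₂ hσ hσs)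

end FlatConnection

/-! ### A global frame of an equivariant line bundle -/

section EquivariantFrame

variable {L : Torus → Type*} [∀ x, AddCommGroup (L x)] [∀ x, Module ℂ (L x)]
  [∀ x, TopologicalSpace (L x)] [TopologicalSpace (TotalSpace ℂ L)] [FiberBundle ℂ L]
  [AddAction Plane (TotalSpace ℂ L)]

theorem TotalSpace.exists_eq_mk {B F : Type*} {V : B → Type*} (p : TotalSpace F V) {x : B}
    (h : p.proj = x) : ∃ v : V x, p = TotalSpace.mk' F x v := by
  subst h
  exact ⟨p.2, rfl⟩

theorem Torus.vadd_cover (v w : Plane) : v +ᵥ cover w = cover (v + w) := rfl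

theorem Torus.cover_eq_zero {n : Plane} (hn : n ∈ intLattice) : cover n = cover 0 :=
  ((QuotientAddGroup.eq_zero_iff n).2 hn).trans (QuotientAddGroup.mk_zero _).symm

/-- The linear action on the fibre over the base point of an element of the lattice. -/
theorem IsEquivariantLineBundle.exists_linear_of_mem
    (hL : IsEquivariantLineBundle Plane 𝓘(ℝ, Plane) L) {n : Plane} (hn : n ∈ intLattice) :
    ∃ A : L (Torus.cover 0) →ₗ[ℂ] L (Torus.cover 0), ∀ v,
      n +ᵥ TotalSpace.mk' ℂ (Torus.cover 0) v = TotalSpace.mk' ℂ (Torus.cover 0) (A v) := by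
  obtain ⟨A, hA⟩ := hL.linear n (Torus.cover 0)
  have h : n +ᵥ Torus.cover 0 = Torus.cover 0 := by
    rw [Torus.vadd_cover, add_zero, Torus.cover_eq_zero hn]
  -- The target fibre of `A` depends on `n +ᵥ cover 0`, so `A` must be generalized before this point
  -- is rewritten to `cover 0`.
  revert A
  rw [h]
  exact fun A hA ↦ ⟨A, hA⟩

/-- The action on an equivariant line bundle maps nonzero vectors to nonzero vectors. -/
theorem IsEquivariantLineBundle.ne_zero (hL : IsEquivariantLineBundle Plane 𝓘(ℝ, Plane) L)
    {g : Plane} {x y : Torus} {v : L x} {w : L y} (hv : v ≠ 0)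
    (h : g +ᵥ TotalSpace.mk' ℂ x v = TotalSpace.mk' ℂ y w) : w ≠ 0 := by
  rintro rfl
  have hz : ∀ (g : Plane) (x : Torus), g +ᵥ TotalSpace.mk' ℂ x (0 : L x) =
      TotalSpace.mk' ℂ (g +ᵥ x) 0 := fun g x ↦ by
    obtain ⟨A, hA⟩ := hL.linear g x
    rw [hA, map_zero]
  have h1 : TotalSpace.mk' ℂ x v = TotalSpace.mk' ℂ (-g +ᵥ y) 0 := by
    rw [← hz, ← h, neg_vadd_vadd]
  have h2 : x = -g +ᵥ y := congrArg TotalSpace.proj h1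
  subst h2
  exact hv (TotalSpace.mk_injective _ h1)

variable [VectorBundle ℂ ℂ L]

/-- A linear endomorphism of a line is a scalar, here nonzero because the action preserves nonzero
vectors. Writing it as an exponential lets the correction in `exists_frame` interpolate it over real
times. -/
theorem IsEquivariantLineBundle.exists_holonomy
    (hL : IsEquivariantLineBundle Plane 𝓘(ℝ, Plane) L) {n : Plane} (hn : n ∈ intLattice) :
    ∃ a : ℂ, ∀ v : L (Torus.cover 0), n +ᵥ TotalSpace.mk' ℂ (Torus.cover 0) v =
      TotalSpace.mk' ℂ (Torus.cover 0) (Complex.exp a • v) := by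
  obtain ⟨A, hA⟩ := hL.exists_linear_of_mem hn
  let e := (trivializationAt ℂ L (Torus.cover 0)).continuousLinearEquivAt ℂ _
    (mem_baseSet_trivializationAt ℂ L (Torus.cover 0))
  have h1 : e.symm 1 ≠ 0 := by simp
  have h2 : ∀ v, v = e v • e.symm 1 := fun v ↦ by
    rw [← map_smul, smul_eq_mul, mul_one, e.symm_apply_apply]
  have h3 : e (A (e.symm 1)) ≠ 0 := by
    simpa using hL.ne_zero h1 (hA _)
  refine ⟨Complex.log (e (A (e.symm 1))), fun v ↦ ?_⟩
  rw [hA, Complex.exp_log h3]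
  congr 1
  conv_lhs => rw [h2 v, map_smul, h2 (A (e.symm 1))]
  conv_rhs => rw [h2 v]
  exact smul_comm _ _ _

theorem IsEquivariantLineBundle.contMDiff_orbit [VectorBundle ℝ ℂ L]
    [ContMDiffVectorBundle ∞ ℂ L 𝓘(ℝ, Plane)]
    (hL : IsEquivariantLineBundle Plane 𝓘(ℝ, Plane) L) {x : Torus} (v : L x) {h : Plane → ℂ}
    (hh : ContDiff ℝ ∞ h) :
    ContMDiff 𝓘(ℝ, Plane) (𝓘(ℝ, Plane).prod 𝓘(ℝ, ℂ)) ∞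
      fun t ↦ t +ᵥ TotalSpace.mk' ℂ x (h t • v) := by
  have h1 : ContMDiff 𝓘(ℝ, Plane) (𝓘(ℝ, Plane).prod 𝓘(ℝ, ℂ)) ∞
      fun t ↦ TotalSpace.mk' ℂ x (h t • v) := by
    intro t
    refine contMDiffAt_totalSpace.2 ⟨contMDiffAt_const, ?_⟩
    -- The vector stays in the fibre over `x`, so one trivialization suffices and its coordinate is
    -- `h` times a constant.
    have h2 : (fun t ↦ (trivializationAt ℂ L x (TotalSpace.mk' ℂ x (h t • v))).2) =
        fun t ↦ h t * (trivializationAt ℂ L x).continuousLinearMapAt ℂ x v := by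
      funext t
      rw [← Trivialization.continuousLinearMapAt_apply_of_mem (R := ℂ) _
        (mem_baseSet_trivializationAt ℂ L x), map_smul, smul_eq_mul]
    exact h2 ▸ (hh.mul contDiff_const).contMDiff t
  exact hL.smooth.comp (contMDiff_id.prodMk h1)

theorem mem_intLattice_iff {v : Plane} : v ∈ intLattice ↔ ∀ i, ∃ n : ℤ, v i = n := Iff.rfl

/-- An equivariant line bundle over the torus has a smooth global frame. -/
theorem IsEquivariantLineBundle.exists_frame [VectorBundle ℝ ℂ L]
    [ContMDiffVectorBundle ∞ ℂ L 𝓘(ℝ, Plane)]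
    (hL : IsEquivariantLineBundle Plane 𝓘(ℝ, Plane) L) :
    ∃ σ : (x : Torus) → L x, (∀ x, σ x ≠ 0) ∧ IsSmoothSection 𝓘(ℝ, Plane) σ := by
  let e : Fin 2 → Plane := fun i ↦ EuclideanSpace.single i 1
  have he : ∀ i, e i ∈ intLattice := fun i j ↦ by
    by_cases hij : j = i
    · exact ⟨1, by simp [e, hij]⟩
    · exact ⟨0, by simp [e, hij]⟩
  choose a ha using fun i ↦ hL.exists_holonomy (he i)
  -- Moving `t` by `e i` multiplies `exp (l t)` by `exp (-a i)`, exactly cancelling the holonomy of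
  -- `e i`.
  let l : Plane → ℂ := fun t ↦ -∑ i, (t i : ℂ) * a i
  have hl : ContDiff ℝ ∞ l := by
    refine (ContDiff.sum fun i _ ↦ ContDiff.mul ?_ contDiff_const).neg
    exact Complex.ofRealCLM.contDiff.comp (by fun_prop)
  have hle : ∀ t i, l (t + e i) + a i = l t := fun t i ↦ by
    fin_cases i <;> simp [l, e, Fin.sum_univ_two] <;> ring
  obtain ⟨v, hv⟩ : ∃ v : L (Torus.cover 0), v ≠ 0 := by
    let e := (trivializationAt ℂ L (Torus.cover 0)).continuousLinearEquivAt ℂ _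
      (mem_baseSet_trivializationAt ℂ L (Torus.cover 0))
    exact ⟨e.symm 1, by simp⟩
  let G : Plane → TotalSpace ℂ L := fun t ↦
    t +ᵥ TotalSpace.mk' ℂ (Torus.cover 0) (Complex.exp (l t) • v)
  have hproj : ∀ t, (G t).proj = Torus.cover t := fun t ↦ by
    rw [hL.proj_vadd]
    exact congrArg Torus.cover (add_zero t)
  have hGs : ContMDiff 𝓘(ℝ, Plane) (𝓘(ℝ, Plane).prod 𝓘(ℝ, ℂ)) ∞ G :=
    hL.contMDiff_orbit v hl.cexp
  have hper : ∀ n ∈ intLattice, ∀ t, G (t + n) = G t := by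
    -- The periods of `G` form a subgroup, so periodicity need only be checked on the generators `e
    -- i`.
    let P : AddSubgroup Plane :=
      { carrier := {n | ∀ t, G (t + n) = G t}
        zero_mem' := fun t ↦ by rw [add_zero]
        add_mem' := fun {m n} hm hn t ↦ by rw [← add_assoc, hn, hm]
        neg_mem' := fun {n} hn t ↦ by rw [← hn (t + -n), neg_add_cancel_right] }
    have hP : ∀ i, e i ∈ P := fun i t ↦ by
      change (t + e i) +ᵥ _ = t +ᵥ _
      rw [add_vadd, ha, ← mul_smul, ← Complex.exp_add, add_comm (a i), hle]
    intro n hn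
    choose m hm using mem_intLattice_iff.1 hn
    have hsum : n = ∑ i, m i • e i := by
      ext j
      fin_cases j <;> simp [e, hm, Fin.sum_univ_two]
    have : n ∈ P := hsum ▸ P.sum_mem fun i _ ↦ P.zsmul_mem (hP i) _
    exact this
  -- Two lifts of `x` differ by a lattice vector, so by periodicity the value of `G` depends on `x`
  -- alone.
  have hex : ∀ x : Torus, ∃ w : L x, ∀ t, Torus.cover t = x → G t = TotalSpace.mk' ℂ x w := by
    intro x
    obtain ⟨t, rfl⟩ := QuotientAddGroup.mk_surjective x
    obtain ⟨w, hw⟩ := TotalSpace.exists_eq_mk (G t) (hproj t)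
    refine ⟨w, fun t' ht' ↦ ?_⟩
    rw [← hw, ← hper _ (QuotientAddGroup.eq.1 ht'.symm) t, add_neg_cancel_left]
  choose σ hσ using hex
  refine ⟨σ, fun x ↦ ?_, Torus.contMDiff_of_comp_cover ?_⟩
  · obtain ⟨t, ht⟩ := QuotientAddGroup.mk_surjective x
    exact hL.ne_zero (smul_ne_zero (Complex.exp_ne_zero _) hv) (hσ x t ht)
  -- The lift of `σ` to the plane is `G`, so smoothness descends along `cover`.
  · convert hGs using 1
    exact funext fun t ↦ (hσ _ t rfl).symm

end EquivariantFrame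

end

theorem mainTheorem3 (L : Torus → Type*) [∀ x, AddCommGroup (L x)] [∀ x, Module ℂ (L x)]
    [∀ x, TopologicalSpace (L x)] [∀ x, IsTopologicalAddGroup (L x)]
    [∀ x, ContinuousSMul ℝ (L x)] [TopologicalSpace (TotalSpace ℂ L)] [FiberBundle ℂ L]
    [VectorBundle ℂ ℂ L] [VectorBundle ℝ ℂ L] [ContMDiffVectorBundle ∞ ℂ L 𝓘(ℝ, Plane)]
    [AddAction Plane (TotalSpace ℂ L)]
    (hL : IsEquivariantLineBundle Plane 𝓘(ℝ, Plane) L) :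
    IsFirstChernClass 𝓘(ℝ, Plane) L 0 := by
  obtain ⟨σ, hσ, hσs⟩ := hL.exists_frame
  exact isFirstChernClass_zero_of_frame hσ hσs
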